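/- Let $N\ge 1$ be an integer and $\gamma_N>0$. Consider the Kuramoto system with coupling $\gamma_N/N$, $$\frac{d\theta_i}{dt}=\omega_i+\frac{\gamma_N}{N}\sum_{j=1}^N\sin(\theta_j-\theta_i),\qquad i=1,\dots,N,$$ and let $\mathbb{R}^N_0=\{\omega\in\mathbb{R}^N:\sum_{i=1}^N\omega_i=0\}$. Let $\mathcal D_N$ be the set of all $\omega\in\mathbb{R}^N_0$ for which this system has a stable fixed point $\theta^*\in\mathbb{R}^N$; here, because of the rotation invariance of the system, stable means (asymptotically) orbitally stable: solutions starting close to the orbit $\{\theta^*+c(1,\dots,1):c\in\mathbb{R}\}$ stay close to it for all $t\ge 0$, and solutions starting sufficiently close to it converge to it as $t\to\infty$. Let $\tau_N=\max_{\phi\in\mathbb{R}}\left[(N-2)\sin\phi+\sin(2\phi)\right]$, and write $\omega_{\max}=\max_i\omega_i$, $\omega_{\min}=\min_i\omega_i$. Then $$\{\omega\in\mathbb{R}^N_0:\omega_{\max}-\omega_{\min}<\gamma_N\}\subseteq\mathcal D_N\subseteq\left\{\omega\in\mathbb{R}^N_0:\omega_{\max}-\omega_{\min}<\frac{2\tau_N\gamma_N}{N}\right\}\subseteq\{\omega\in\mathbb{R}^N_0:\omega_{\max}-\omega_{\min}<2\gamma_N\}.$$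 -/

import Mathlib

open Set Filter Topology

noncomputable section

/-- The mean-zero subspace `ℝ^N_0` of `ℝ^N`. -/
def meanZero (N : ℕ) : Set (Fin N → ℝ) := {ω | ∑ i, ω i = 0}

/-- The spread `ω_max - ω_min`. -/
def spread {N : ℕ} (ω : Fin N → ℝ) : ℝ := (⨆ i, ω i) - ⨅ i, ω i

/-- The function of `φ` whose maximum is the Chopra-Spong constant. -/
def chopraSpongFun (N : ℕ) (φ : ℝ) : ℝ :=
  ((N : ℝ) - 2) * Real.sin φ + Real.sin (2 * φ)

/-- The Chopra-Spong constant `τ_N`; the supremum is attained, see `chopraSpong_isGreatest`. -/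
def chopraSpong (N : ℕ) : ℝ := ⨆ φ : ℝ, chopraSpongFun N φ

theorem chopraSpong_isGreatest (N : ℕ) :
    IsGreatest (Set.range (chopraSpongFun N)) (chopraSpong N) := by
  have hc : Continuous (chopraSpongFun N) := by
    unfold chopraSpongFun
    fun_prop
  have hp : Function.Periodic (chopraSpongFun N) (2 * Real.pi) := by
    intro x
    have h : 2 * (x + 2 * Real.pi) = 2 * x + 2 * Real.pi + 2 * Real.pi := by ring
    simp only [chopraSpongFun, h, Real.sin_add_two_pi]
  have hcomp : IsCompact (Set.range (chopraSpongFun N)) :=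
    hp.compact_of_continuous (by positivity) hc
  exact hcomp.isGreatest_sSup (Set.range_nonempty _)

/-- The right-hand side of the Kuramoto system
`dθ_i/dt = ω_i + (γ/N) ∑_j sin (θ_j - θ_i)` with coupling `γ/N`. -/
def kuramotoField {N : ℕ} (γ : ℝ) (ω θ : Fin N → ℝ) : Fin N → ℝ :=
  fun i => ω i + γ / (N : ℝ) * ∑ j, Real.sin (θ j - θ i)

/-- `x` solves the Kuramoto system on `[0, ∞)`. -/
def IsKuramotoSolution {N : ℕ} (γ : ℝ) (ω : Fin N → ℝ) (x : ℝ → Fin N → ℝ) : Prop :=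
  ∀ t, 0 ≤ t → HasDerivWithinAt x (kuramotoField γ ω (x t)) (Ici 0) t

/-- The orbit of a configuration under the rotations `θ ↦ θ + (c, …, c)`, which are
symmetries of the Kuramoto system. -/
def rotationOrbit {N : ℕ} (θ : Fin N → ℝ) : Set (Fin N → ℝ) :=
  Set.range fun c : ℝ => fun i => θ i + c

/-- `θ` is a stable fixed point of the Kuramoto system. Because of the rotational
invariance, stability is (asymptotic) orbital stability: solutions starting close to the
rotation orbit of `θ` remain close to it, and solutions starting sufficiently close to it
converge to it. (Distances are in the sup norm; the notion does not depend on the norm.) -/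
structure IsStableFixedPoint {N : ℕ} (γ : ℝ) (ω θ : Fin N → ℝ) : Prop where
  fixed : kuramotoField γ ω θ = 0
  stable : ∀ ε > 0, ∃ δ > 0, ∀ x : ℝ → Fin N → ℝ, IsKuramotoSolution γ ω x →
    Metric.infDist (x 0) (rotationOrbit θ) < δ →
      ∀ t, 0 ≤ t → Metric.infDist (x t) (rotationOrbit θ) < ε
  attracting : ∃ δ > 0, ∀ x : ℝ → Fin N → ℝ, IsKuramotoSolution γ ω x →
    Metric.infDist (x 0) (rotationOrbit θ) < δ →
      Tendsto (fun t => Metric.infDist (x t) (rotationOrbit θ)) atTop (𝓝 0)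

/-- The stable phase-locked region `𝒟_N` for coupling `γ/N`. -/
def phaseLockedRegion (N : ℕ) (γ : ℝ) : Set (Fin N → ℝ) :=
  {ω | ω ∈ meanZero N ∧ ∃ θ : Fin N → ℝ, IsStableFixedPoint γ ω θ}

end

/-! ### Global solutions of bounded Lipschitz autonomous systems -/

/-! Sufficiency: the field is minus the gradient of `kuramotoEnergy`, which on mean-zero `ω` is
rotation invariant and so attains a minimum on `quarterArc`. If two phases of a minimizer were
exactly `π / 2` apart, the coupling would beat `ω i - ω k < γ`, and moving them together would lower
the energy. So the minimizer is interior, hence a fixed point with all differences below `π / 2`.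
There `sin` is strongly monotone in the differences, and `pairEnergy (x - θ)` decays exponentially.

Necessity: at any fixed point `ω i - ω k` is `γ / N` times a sum of sines, at most `2 * chopraSpong
N` by sum-to-product around half the angle `θ i - θ k`. Stability serves only to make this strict.
In the equality case the other phases sit at the midpoint, so the line through `θ` that separates
`i` and `k` symmetrically is invariant; the half angle maximizes `chopraSpongFun`, so motion along
this line never returns, contradicting attraction. -/

theorem exists_global_solution_of_lipschitzWith {E : Type*} [NormedAddCommGroup E]
    [NormedSpace ℝ E] [CompleteSpace E] {v : E → E} {K L : NNReal} (hv : LipschitzWith K v)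
    (hL : ∀ x, ‖v x‖ ≤ L) (x₀ : E) :
    ∃ α : ℝ → E, α 0 = x₀ ∧ ∀ t, HasDerivAt α (v (α t)) t := by
  have hloc : ∀ a : NNReal, ∃ α : ℝ → E, α 0 = x₀ ∧
      ∀ t ∈ Icc (-(a : ℝ)) a, HasDerivWithinAt α (v (α t)) (Icc (-(a : ℝ)) a) t := by
    intro a
    have h0 : (0 : ℝ) ∈ Icc (-(a : ℝ)) a := by simp
    -- Speed at most `L` keeps trajectories within distance `L * a` up to time `a`, so every
    -- interval is admissible.
    have hp : IsPicardLindelof (fun _ => v) (⟨0, h0⟩ : Icc (-(a : ℝ)) a) x₀ (L * a) 0 L K :=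
      IsPicardLindelof.of_time_independent (fun x _ => hL x) hv.lipschitzOnWith (by simp)
    exact hp.exists_eq_forall_mem_Icc_hasDerivWithinAt₀
  choose α hα0 hα using hloc
  have hderiv : ∀ (a : NNReal), ∀ t ∈ Ioo (-(a : ℝ)) a, HasDerivAt (α a) (v (α a t)) t :=
    fun a t ht => (hα a t (Ioo_subset_Icc_self ht)).hasDerivAt (Icc_mem_nhds ht.1 ht.2)
  have huniq : ∀ a b : NNReal, a ≤ b → EqOn (α a) (α b) (Ioo (-(a : ℝ)) a) := by
    intro a b hab t ht
    have hab' : (a : ℝ) ≤ b := hab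
    have h0 : (0 : ℝ) ∈ Ioo (-(a : ℝ)) a := by
      constructor <;> linarith [ht.1, ht.2]
    exact ODE_solution_unique_of_mem_Ioo (v := fun _ => v) (s := fun _ => univ) (K := K)
      (fun _ _ => hv.lipschitzOnWith) h0 (fun s hs => ⟨hderiv a s hs, trivial⟩)
      (fun s hs => ⟨hderiv b s ⟨by linarith [hs.1], by linarith [hs.2]⟩, trivial⟩)
      ((hα0 a).trans (hα0 b).symm) ht
  let r : ℝ → NNReal := fun t => ‖t‖₊ + 1
  have hr : ∀ t, t ∈ Ioo (-(r t : ℝ)) (r t) := by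
    intro t
    rw [mem_Ioo, ← abs_lt]
    simp [r]
  have hglue : ∀ a : NNReal, EqOn (fun t => α (r t) t) (α a) (Ioo (-(a : ℝ)) a) := by
    intro a t ht
    rcases le_total (r t) a with h | h
    · exact huniq _ _ h (hr t)
    · exact (huniq _ _ h ht).symm
  refine ⟨fun t => α (r t) t, hα0 _, fun t => ?_⟩
  exact (hderiv (r t) t (hr t)).congr_of_eventuallyEq
    ((hglue (r t)).eventuallyEq_of_mem (Ioo_mem_nhds (hr t).1 (hr t).2))

/-! ### Spread, orbit distance and elementary facts -/

section Spread

variable {N : ℕ}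

theorem sub_le_spread (ω : Fin N → ℝ) (i j : Fin N) : ω i - ω j ≤ spread ω :=
  sub_le_sub (le_ciSup (Set.finite_range ω).bddAbove i) (ciInf_le (Set.finite_range ω).bddBelow j)

theorem exists_spread_eq (hN : 1 ≤ N) (ω : Fin N → ℝ) : ∃ i k, spread ω = ω i - ω k := by
  have : Nonempty (Fin N) := ⟨⟨0, hN⟩⟩
  obtain ⟨i, hi⟩ := exists_eq_ciSup_of_finite (f := ω)
  obtain ⟨k, hk⟩ := exists_eq_ciInf_of_finite (f := ω)
  exact ⟨i, k, by rw [spread, hi, hk]⟩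

end Spread

section Orbit

variable {N : ℕ}

theorem rotationOrbit_nonempty (θ : Fin N → ℝ) : (rotationOrbit θ).Nonempty :=
  Set.range_nonempty _

/-- Pairwise differences cancel the unknown rotation `c`, at the cost of a factor 2. -/
theorem abs_sub_sub_lt_of_infDist_rotationOrbit_lt {θ x : Fin N → ℝ} {δ : ℝ}
    (h : Metric.infDist x (rotationOrbit θ) < δ) (i j : Fin N) :
    |(x i - θ i) - (x j - θ j)| < 2 * δ := by
  obtain ⟨_, ⟨c, rfl⟩, hy⟩ := (Metric.infDist_lt_iff (rotationOrbit_nonempty θ)).1 h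
  have hi := (dist_le_pi_dist x (fun i => θ i + c) i).trans_lt hy
  have hj := (dist_le_pi_dist x (fun i => θ i + c) j).trans_lt hy
  rw [Real.dist_eq, abs_lt] at hi hj
  rw [abs_lt]
  constructor <;> linarith [hi.1, hi.2, hj.1, hj.2]

theorem infDist_rotationOrbit_le {θ x : Fin N → ℝ} {c δ : ℝ} (hδ : 0 ≤ δ)
    (h : ∀ i, |x i - θ i - c| ≤ δ) : Metric.infDist x (rotationOrbit θ) ≤ δ := by
  have hc : (fun i => θ i + c) ∈ rotationOrbit θ := ⟨c, rfl⟩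
  refine (Metric.infDist_le_dist_of_mem hc).trans ((dist_pi_le_iff hδ).2 fun i => ?_)
  rw [Real.dist_eq, ← sub_sub]
  exact h i

end Orbit

/-- Mean value inequality with `cos ≥ cos β` on `[-β, β]`; this is the source of the contraction. -/
theorem mul_sq_sub_le_mul_sin_sub_sin {β s t : ℝ} (hβ : β ≤ Real.pi) (hs : |s| ≤ β)
    (ht : |t| ≤ β) :
    Real.cos β * (s - t) ^ 2 ≤ (s - t) * (Real.sin s - Real.sin t) := by
  have key : ∀ x ∈ Icc (-β) β, ∀ y ∈ Icc (-β) β, x ≤ y →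
      Real.cos β * (y - x) ≤ Real.sin y - Real.sin x := by
    refine (convex_Icc (-β) β).mul_sub_le_image_sub_of_le_deriv Real.continuous_sin.continuousOn
      Real.differentiable_sin.differentiableOn fun x hx => ?_
    rw [Real.deriv_sin, ← Real.cos_abs x]
    have hx' : x ∈ Icc (-β) β := interior_subset hx
    exact Real.cos_le_cos_of_nonneg_of_le_pi (abs_nonneg _) hβ (abs_le.2 hx')
  rcases le_total s t with h | h
  · nlinarith [key s (abs_le.1 hs) t (abs_le.1 ht) h]
  · nlinarith [key t (abs_le.1 ht) s (abs_le.1 hs) h]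

theorem sum_sum_mul_antisymm {ι : Type*} [Fintype ι] (y : ι → ℝ) (s : ι → ι → ℝ)
    (hs : ∀ i j, s i j = -s j i) :
    2 * ∑ i, ∑ j, y i * s i j = -∑ i, ∑ j, (y j - y i) * s i j := by
  have h : ∑ i, ∑ j, y j * s i j = -∑ i, ∑ j, y i * s i j := by
    rw [Finset.sum_comm, ← Finset.sum_neg_distrib]
    refine Finset.sum_congr rfl fun i _ => ?_
    rw [← Finset.sum_neg_distrib]
    exact Finset.sum_congr rfl fun j _ => by rw [hs j i, mul_neg]
  simp only [sub_mul, Finset.sum_sub_distrib, h]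
  ring

theorem sum_sum_eq_zero_of_antisymm {ι : Type*} [Fintype ι] (s : ι → ι → ℝ)
    (hs : ∀ i j, s i j = -s j i) : ∑ i, ∑ j, s i j = 0 := by
  have h := sum_sum_mul_antisymm (fun _ => 1) s hs
  simpa using h

/-! ### The Lyapunov function -/

section Lyapunov

variable {N : ℕ}

/-- The sum of the squared pairwise differences of `y`. -/
noncomputable def pairEnergy (y : Fin N → ℝ) : ℝ := ∑ i, ∑ j, (y i - y j) ^ 2

theorem abs_sub_le_sqrt_pairEnergy (y : Fin N → ℝ) (i j : Fin N) :
    |y i - y j| ≤ √(pairEnergy y) := by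
  apply Real.abs_le_sqrt
  calc (y i - y j) ^ 2 ≤ ∑ j, (y i - y j) ^ 2 :=
        Finset.single_le_sum (f := fun j => (y i - y j) ^ 2) (fun _ _ => sq_nonneg _)
          (Finset.mem_univ j)
    _ ≤ pairEnergy y :=
        Finset.single_le_sum (f := fun i => ∑ j, (y i - y j) ^ 2)
          (fun _ _ => Finset.sum_nonneg fun _ _ => sq_nonneg _) (Finset.mem_univ i)

theorem pairEnergy_le_of_abs_sub_le {y : Fin N → ℝ} {r : ℝ} (h : ∀ i j, |y i - y j| ≤ r) :
    pairEnergy y ≤ (N : ℝ) ^ 2 * r ^ 2 := by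
  calc pairEnergy y ≤ ∑ _i : Fin N, ∑ _j : Fin N, r ^ 2 :=
        Finset.sum_le_sum fun i _ => Finset.sum_le_sum fun j _ =>
          sq_le_sq' (abs_le.1 (h i j)).1 (abs_le.1 (h i j)).2
    _ = (N : ℝ) ^ 2 * r ^ 2 := by simp; ring

theorem sum_kuramotoField_eq_zero {γ : ℝ} {ω x : Fin N → ℝ} (hω : ω ∈ meanZero N) :
    ∑ i, kuramotoField γ ω x i = 0 := by
  have hω' : ∑ i, ω i = 0 := hω
  simp only [kuramotoField, Finset.sum_add_distrib, hω', ← Finset.mul_sum]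
  rw [sum_sum_eq_zero_of_antisymm (fun i j => Real.sin (x j - x i))]
  · simp
  · intro i j
    rw [← Real.sin_neg, neg_sub]

/-- Along the Kuramoto field, `pairEnergy (x - θ)` decays at the rate `2 γ cos β` as long as all
phase differences of `x` and of the fixed point `θ` are at most `β`. -/
theorem pairEnergy_deriv_le {γ β : ℝ} (hγ : 0 < γ) (hN : 1 ≤ N) (hβ : β ≤ Real.pi)
    {ω θ x : Fin N → ℝ} (hω : ω ∈ meanZero N) (hfix : kuramotoField γ ω θ = 0)
    (hθ : ∀ i j, |θ i - θ j| ≤ β) (hx : ∀ i j, |x i - x j| ≤ β) :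
    ∑ i, ∑ j, 2 * ((x i - θ i) - (x j - θ j)) *
        (kuramotoField γ ω x i - kuramotoField γ ω x j) ≤
      -(2 * γ * Real.cos β) * pairEnergy (x - θ) := by
  have hN' : (0 : ℝ) < N := by exact_mod_cast hN
  set y : Fin N → ℝ := x - θ with hy
  set F := kuramotoField γ ω x with hF
  set s : Fin N → Fin N → ℝ := fun i j => Real.sin (x j - x i) - Real.sin (θ j - θ i) with hs
  have hanti : ∀ i j, s i j = -s j i := by
    intro i j
    simp only [hs]
    rw [← neg_sub (x i), ← neg_sub (θ i), Real.sin_neg, Real.sin_neg]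
    ring
  have hFs : ∀ i, F i = γ / N * ∑ j, s i j := by
    intro i
    have h0 : kuramotoField γ ω θ i = 0 := by rw [hfix]; rfl
    simp only [hF, hs, kuramotoField, Finset.sum_sub_distrib] at h0 ⊢
    rw [mul_sub]
    linarith
  have hsum : ∑ i, F i = 0 := sum_kuramotoField_eq_zero hω
  -- The cross terms vanish because the field sums to zero.
  have h1 : ∑ i, ∑ j, 2 * ((x i - θ i) - (x j - θ j)) * (F i - F j) =
      4 * N * ∑ i, y i * F i := by
    have e : ∀ i j, 2 * ((x i - θ i) - (x j - θ j)) * (F i - F j) =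
        2 * (y i * F i) - 2 * y i * F j - 2 * F i * y j + 2 * (y j * F j) := by
      intro i j
      simp only [hy, Pi.sub_apply]
      ring
    simp only [e, Finset.sum_add_distrib, Finset.sum_sub_distrib, Finset.sum_const,
      Finset.card_univ, Fintype.card_fin, nsmul_eq_mul]
    simp only [← Finset.mul_sum, ← Finset.sum_mul, hsum]
    ring
  have h2 : ∑ i, y i * F i = γ / N * ∑ i, ∑ j, y i * s i j := by
    rw [Finset.mul_sum]
    refine Finset.sum_congr rfl fun i _ => ?_
    rw [hFs, ← Finset.mul_sum]
    ring
  have h3 : Real.cos β * pairEnergy y ≤ ∑ i, ∑ j, (y j - y i) * s i j := by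
    rw [pairEnergy, Finset.mul_sum]
    refine Finset.sum_le_sum fun i _ => ?_
    rw [Finset.mul_sum]
    refine Finset.sum_le_sum fun j _ => ?_
    have := mul_sq_sub_le_mul_sin_sub_sin hβ (hx j i) (hθ j i)
    have e : x j - x i - (θ j - θ i) = y j - y i := by
      simp only [hy, Pi.sub_apply]
      ring
    rw [e] at this
    calc Real.cos β * (y i - y j) ^ 2 = Real.cos β * (y j - y i) ^ 2 := by ring
      _ ≤ _ := this
  have h4 := sum_sum_mul_antisymm y s hanti
  have h5 : 4 * (N : ℝ) * ∑ i, y i * F i = -(2 * γ) * ∑ i, ∑ j, (y j - y i) * s i j := by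
    rw [h2]
    have : 4 * (N : ℝ) * (γ / N * ∑ i, ∑ j, y i * s i j) =
        2 * γ * (2 * ∑ i, ∑ j, y i * s i j) := by
      field_simp
      ring
    rw [this, h4]
    ring
  rw [h1, h5]
  nlinarith

theorem IsKuramotoSolution.hasDerivWithinAt_apply {γ : ℝ} {ω : Fin N → ℝ} {x : ℝ → Fin N → ℝ}
    (hx : IsKuramotoSolution γ ω x) {t : ℝ} (ht : 0 ≤ t) (i : Fin N) :
    HasDerivWithinAt (fun s => x s i) (kuramotoField γ ω (x t) i) (Ici 0) t :=
  hasDerivWithinAt_pi.1 (hx t ht) i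

theorem hasDerivWithinAt_pairEnergy {γ : ℝ} {ω θ : Fin N → ℝ} {x : ℝ → Fin N → ℝ}
    (hx : IsKuramotoSolution γ ω x) {t : ℝ} (ht : 0 ≤ t) :
    HasDerivWithinAt (fun s => pairEnergy (x s - θ))
      (∑ i, ∑ j, 2 * ((x t i - θ i) - (x t j - θ j)) *
        (kuramotoField γ ω (x t) i - kuramotoField γ ω (x t) j)) (Ici 0) t := by
  unfold pairEnergy
  refine HasDerivWithinAt.fun_sum fun i _ => HasDerivWithinAt.fun_sum fun j _ => ?_
  have h := ((((hx.hasDerivWithinAt_apply ht i).sub_const (θ i)).sub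
    ((hx.hasDerivWithinAt_apply ht j).sub_const (θ j))).pow 2)
  refine h.congr_deriv ?_
  simp

/-- If the initial pair energy is small, the pair energy decays exponentially. -/
theorem pairEnergy_le_exp {γ β r : ℝ} (hγ : 0 < γ) (hN : 1 ≤ N) (hβr : β + r < Real.pi / 2)
    (hβ : 0 ≤ β) (hr : 0 < r) {ω θ : Fin N → ℝ} (hω : ω ∈ meanZero N)
    (hfix : kuramotoField γ ω θ = 0) (hθ : ∀ i j, |θ i - θ j| ≤ β) {x : ℝ → Fin N → ℝ}
    (hx : IsKuramotoSolution γ ω x) {B : ℝ} (hB : 0 < B) (hBr : B ≤ r ^ 2)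
    (h0 : pairEnergy (x 0 - θ) ≤ B) {t : ℝ} (ht : 0 ≤ t) :
    pairEnergy (x t - θ) ≤ B * Real.exp (-(γ * Real.cos (β + r)) * t) := by
  have hcos : 0 < Real.cos (β + r) := Real.cos_pos_of_mem_Ioo ⟨by linarith, hβr⟩
  have hpi := Real.pi_pos
  have hd : ∀ s, HasDerivAt (fun s => B * Real.exp (-(γ * Real.cos (β + r)) * s))
      (B * (Real.exp (-(γ * Real.cos (β + r)) * s) * -(γ * Real.cos (β + r)))) s := by
    intro s
    have := (((hasDerivAt_id s).const_mul (-(γ * Real.cos (β + r)))).exp).const_mul B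
    simpa using this
  -- Barrier argument: the exponent is half the rate of `pairEnergy_deriv_le`, which gives the
  -- strict inequality needed wherever the two curves touch.
  refine image_le_of_deriv_right_lt_deriv_boundary' (a := 0) (b := t)
    (f := fun s => pairEnergy (x s - θ))
    (fun s hs => ((hasDerivWithinAt_pairEnergy hx hs.1).continuousWithinAt.mono
      Icc_subset_Ici_self))
    (fun s hs => (hasDerivWithinAt_pairEnergy hx hs.1).mono (Ici_subset_Ici.2 hs.1))
    (by simpa using h0) (fun s _ => (hd s).continuousAt.continuousWithinAt)
    (fun s _ => (hd s).hasDerivWithinAt) ?_ (right_mem_Icc.2 ht)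
  intro s hs heq
  set V := pairEnergy (x s - θ) with hV
  have hVpos : 0 < V := by rw [heq]; positivity
  have hVr : V ≤ r ^ 2 := by
    refine le_trans ?_ hBr
    rw [heq]
    refine mul_le_of_le_one_right hB.le (Real.exp_le_one_iff.2 ?_)
    have := mul_nonneg (mul_pos hγ hcos).le hs.1
    linarith
  have hsqrt : √V ≤ r := Real.sqrt_le_iff.2 ⟨hr.le, hVr⟩
  have hxs : ∀ i j, |x s i - x s j| ≤ β + r := by
    intro i j
    have h1 := (abs_sub_le_sqrt_pairEnergy (x s - θ) i j).trans hsqrt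
    have e : x s i - x s j = (θ i - θ j) + ((x s - θ) i - (x s - θ) j) := by
      simp only [Pi.sub_apply]
      ring
    rw [e]
    exact (abs_add_le _ _).trans (add_le_add (hθ i j) h1)
  have hle := pairEnergy_deriv_le hγ hN (by linarith) hω hfix
    (fun i j => (hθ i j).trans (by linarith)) hxs
  refine hle.trans_lt ?_
  rw [← mul_assoc, ← heq, ← hV]
  nlinarith [mul_pos (mul_pos hγ hcos) hVpos]

theorem isStableFixedPoint_of_abs_sub_lt {γ : ℝ} (hγ : 0 < γ) (hN : 1 ≤ N) {ω θ : Fin N → ℝ}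
    (hω : ω ∈ meanZero N) (hfix : kuramotoField γ ω θ = 0)
    (hθ : ∀ i j, θ i - θ j < Real.pi / 2) : IsStableFixedPoint γ ω θ := by
  have hN' : (0 : ℝ) < N := by exact_mod_cast hN
  obtain ⟨p, k, hpk⟩ := exists_spread_eq hN θ
  set β := spread θ with hβdef
  have hθβ : ∀ i j, |θ i - θ j| ≤ β := fun i j =>
    abs_le.2 ⟨by linarith [sub_le_spread θ j i], sub_le_spread θ i j⟩
  have hβ0 : 0 ≤ β := (abs_nonneg _).trans (hθβ p p)
  have hβ : β < Real.pi / 2 := hpk ▸ hθ p k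
  obtain ⟨r, hr, hβr⟩ : ∃ r > 0, β + r < Real.pi / 2 :=
    ⟨(Real.pi / 2 - β) / 2, by linarith, by linarith⟩
  have hcos : 0 < Real.cos (β + r) := Real.cos_pos_of_mem_Ioo ⟨by linarith, hβr⟩
  have hκ : 0 < γ * Real.cos (β + r) := mul_pos hγ hcos
  -- a solution starting in the `ρ / (2N)`-neighbourhood stays `ρ`-close and converges
  have key : ∀ ρ, 0 < ρ → ρ ≤ r → ∀ x : ℝ → Fin N → ℝ, IsKuramotoSolution γ ω x →
      Metric.infDist (x 0) (rotationOrbit θ) < ρ / (2 * N) → ∀ t, 0 ≤ t →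
      Metric.infDist (x t) (rotationOrbit θ) ≤
        √(ρ ^ 2 * Real.exp (-(γ * Real.cos (β + r)) * t)) := by
    intro ρ hρ hρr x hx h0 t ht
    -- Each of the `N ^ 2` pairwise differences is below `2 * (ρ / (2 * N)) = ρ / N`.
    have hV0 : pairEnergy (x 0 - θ) ≤ ρ ^ 2 := by
      refine (pairEnergy_le_of_abs_sub_le fun i j =>
        (abs_sub_sub_lt_of_infDist_rotationOrbit_lt h0 i j).le).trans_eq ?_
      field_simp
    have hVt := pairEnergy_le_exp hγ hN hβr hβ0 hr hω hfix hθβ hx (by positivity)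
      (pow_le_pow_left₀ hρ.le hρr 2) hV0 ht
    exact infDist_rotationOrbit_le (Real.sqrt_nonneg _) (c := (x t - θ) p) fun i =>
      (abs_sub_le_sqrt_pairEnergy (x t - θ) i p).trans (Real.sqrt_le_sqrt hVt)
  refine ⟨hfix, fun ε hε => ?_, r / (2 * N), by positivity, fun x hx h0 => ?_⟩
  · have hρ : 0 < min (ε / 2) r := by positivity
    refine ⟨min (ε / 2) r / (2 * N), by positivity, fun x hx h0 t ht => ?_⟩
    calc Metric.infDist (x t) (rotationOrbit θ)
        ≤ √(min (ε / 2) r ^ 2 * Real.exp (-(γ * Real.cos (β + r)) * t)) :=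
          key _ hρ (min_le_right _ _) x hx h0 t ht
      _ ≤ √(min (ε / 2) r ^ 2) := by
          refine Real.sqrt_le_sqrt (mul_le_of_le_one_right (sq_nonneg _)
            (Real.exp_le_one_iff.2 ?_))
          have := mul_nonneg hκ.le ht
          linarith
      _ = min (ε / 2) r := Real.sqrt_sq hρ.le
      _ ≤ ε / 2 := min_le_left _ _
      _ < ε := by linarith
  · have hlim : Tendsto (fun t => √(r ^ 2 * Real.exp (-(γ * Real.cos (β + r)) * t))) atTop
        (𝓝 0) := by
      have h1 : Tendsto (fun t => -(γ * Real.cos (β + r)) * t) atTop atBot :=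
        tendsto_id.const_mul_atTop_of_neg (neg_lt_zero.2 hκ)
      have h2 := ((Real.tendsto_exp_atBot.comp h1).const_mul (r ^ 2)).sqrt
      simpa using h2
    refine tendsto_of_tendsto_of_tendsto_of_le_of_le' tendsto_const_nhds hlim
      (Eventually.of_forall fun _ => Metric.infDist_nonneg) ?_
    filter_upwards [eventually_ge_atTop 0] with t ht
    exact key r hr le_rfl x hx h0 t ht

end Lyapunov

/-! ### Phase-locked states as energy minimizers -/

section Energy

variable {N : ℕ}

/-- The energy whose negative gradient is the Kuramoto field. -/
noncomputable def kuramotoEnergy (γ : ℝ) (ω θ : Fin N → ℝ) : ℝ :=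
  -∑ i, ω i * θ i - γ / (2 * N) * ∑ i, ∑ j, Real.cos (θ j - θ i)

theorem continuous_kuramotoEnergy (γ : ℝ) (ω : Fin N → ℝ) :
    Continuous (kuramotoEnergy γ ω) := by
  unfold kuramotoEnergy
  fun_prop

theorem kuramotoEnergy_sub_const {γ : ℝ} {ω : Fin N → ℝ} (hω : ω ∈ meanZero N)
    (θ : Fin N → ℝ) (c : ℝ) :
    kuramotoEnergy γ ω (fun i => θ i - c) = kuramotoEnergy γ ω θ := by
  have hω' : ∑ i, ω i = 0 := hω
  simp [kuramotoEnergy, mul_sub, Finset.sum_sub_distrib, ← Finset.sum_mul, hω']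

theorem hasDerivAt_kuramotoEnergy_line (γ : ℝ) (ω θ v : Fin N → ℝ) :
    HasDerivAt (fun s : ℝ => kuramotoEnergy γ ω (fun i => θ i + s * v i))
      (-∑ i, v i * kuramotoField γ ω θ i) 0 := by
  have hlin : ∀ i, HasDerivAt (fun s : ℝ => θ i + s * v i) (v i) 0 := fun i => by
    simpa using ((hasDerivAt_id (0 : ℝ)).mul_const (v i)).const_add (θ i)
  have h1 : HasDerivAt (fun s : ℝ => ∑ i, ω i * (θ i + s * v i)) (∑ i, ω i * v i) 0 :=
    HasDerivAt.fun_sum fun i _ => (hlin i).const_mul (ω i)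
  have h2 : HasDerivAt (fun s : ℝ => ∑ i, ∑ j, Real.cos ((θ j + s * v j) - (θ i + s * v i)))
      (∑ i, ∑ j, (v j - v i) * -Real.sin (θ j - θ i)) 0 := by
    refine HasDerivAt.fun_sum fun i _ => HasDerivAt.fun_sum fun j _ => ?_
    refine (((hlin j).sub (hlin i)).cos).congr_deriv ?_
    simp
    ring
  have h := h1.neg.sub (h2.const_mul (γ / (2 * N)))
  refine h.congr_deriv ?_
  have hanti := sum_sum_mul_antisymm v (fun i j => Real.sin (θ j - θ i)) fun i j => by
    rw [← Real.sin_neg, neg_sub]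
  have e : ∑ i, v i * kuramotoField γ ω θ i =
      ∑ i, ω i * v i + γ / N * ∑ i, ∑ j, v i * Real.sin (θ j - θ i) := by
    rw [Finset.mul_sum, ← Finset.sum_add_distrib]
    refine Finset.sum_congr rfl fun i _ => ?_
    rw [kuramotoField, ← Finset.mul_sum]
    ring
  rw [e]
  simp only [mul_neg, Finset.sum_neg_distrib]
  have hhalf : γ / (2 * (N : ℝ)) = γ / N / 2 := by rw [mul_comm, div_div]
  rw [hhalf]
  linear_combination (γ / N / 2) * hanti

/-- Configurations contained in a quarter arc. -/
def quarterArc (N : ℕ) : Set (Fin N → ℝ) := {θ | ∀ i j, θ i - θ j ≤ Real.pi / 2}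

/-- Fixing one phase at zero removes the rotations and leaves a compact slice. -/
theorem exists_isMinOn_quarterArc (hN : 1 ≤ N) {γ : ℝ} {ω : Fin N → ℝ} (hω : ω ∈ meanZero N) :
    ∃ θ ∈ quarterArc N, IsMinOn (kuramotoEnergy γ ω) (quarterArc N) θ := by
  let o : Fin N := ⟨0, hN⟩
  let K : Set (Fin N → ℝ) := {θ | θ o = 0} ∩ quarterArc N
  have hclosed : IsClosed K := by
    refine (isClosed_eq (continuous_apply o) continuous_const).inter ?_
    simp only [quarterArc, ofPred_forall]
    exact isClosed_iInter fun i => isClosed_iInter fun j =>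
      isClosed_le ((continuous_apply i).sub (continuous_apply j)) continuous_const
  have hsub : K ⊆ Icc (fun _ => -(Real.pi / 2)) (fun _ => Real.pi / 2) := by
    rintro θ ⟨h0, h⟩
    have h0' : θ o = 0 := h0
    exact ⟨fun i => by linarith [h o i], fun i => by linarith [h i o]⟩
  have hK : IsCompact K := isCompact_Icc.of_isClosed_subset hclosed hsub
  have hne : K.Nonempty := ⟨0, rfl, fun i j => by simpa using Real.pi_div_two_pos.le⟩
  obtain ⟨θ, hθK, hmin⟩ := hK.exists_isMinOn hne (continuous_kuramotoEnergy γ ω).continuousOn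
  refine ⟨θ, hθK.2, fun x hx => ?_⟩
  have hx' : (fun i => x i - x o) ∈ K := ⟨sub_self _, fun i j => by simpa using hx i j⟩
  have := hmin hx'
  simpa only [mem_ofPred_eq, kuramotoEnergy_sub_const hω] using this

/-- `(sin a + cos a) ^ 2 = 1 + 2 * sin a * cos a ≥ 1`. -/
theorem one_le_sin_add_sin {a b : ℝ} (ha : 0 ≤ a) (hb : 0 ≤ b) (hab : a + b = Real.pi / 2) :
    1 ≤ Real.sin a + Real.sin b := by
  obtain rfl : b = Real.pi / 2 - a := by linarith
  rw [Real.sin_pi_div_two_sub]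
  have hs := Real.sin_nonneg_of_nonneg_of_le_pi ha (by linarith [Real.pi_pos])
  have hc := Real.cos_nonneg_of_neg_pi_div_two_le_of_le (x := a)
    (by linarith [Real.pi_pos]) (by linarith)
  nlinarith [Real.sin_sq_add_cos_sq a, mul_nonneg hs hc]

theorem kuramotoField_sub (γ : ℝ) (ω θ : Fin N → ℝ) (i k : Fin N) :
    kuramotoField γ ω θ i - kuramotoField γ ω θ k =
      ω i - ω k - γ / N * ∑ j, (Real.sin (θ i - θ j) + Real.sin (θ j - θ k)) := by
  have h : ∀ j, Real.sin (θ j - θ i) = -Real.sin (θ i - θ j) := fun j => by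
    rw [← Real.sin_neg, neg_sub]
  simp only [kuramotoField, Finset.sum_add_distrib, h, Finset.sum_neg_distrib]
  ring

/-- The field points into the quarter arc at its extreme points. -/
theorem kuramotoField_sub_neg_of_extremal {γ : ℝ} (hγ : 0 < γ) {ω θ : Fin N → ℝ}
    (hω : spread ω < γ) (hθ : θ ∈ quarterArc N) {i k : Fin N}
    (hik : θ i - θ k = Real.pi / 2) :
    kuramotoField γ ω θ i - kuramotoField γ ω θ k < 0 := by
  have hN' : (0 : ℝ) < N := by exact_mod_cast i.pos
  have hsum : (N : ℝ) ≤ ∑ j, (Real.sin (θ i - θ j) + Real.sin (θ j - θ k)) := by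
    calc (N : ℝ) = ∑ _j : Fin N, (1 : ℝ) := by simp
      _ ≤ _ := Finset.sum_le_sum fun j _ => one_le_sin_add_sin
        (by linarith [hθ j k]) (by linarith [hθ i j]) (by linarith)
  have h1 : γ ≤ γ / N * ∑ j, (Real.sin (θ i - θ j) + Real.sin (θ j - θ k)) := by
    calc γ = γ / N * N := by field_simp
      _ ≤ _ := by gcongr
  rw [kuramotoField_sub]
  linarith [sub_le_spread ω i k]

theorem HasDerivAt.nonneg_of_eventually_ge_right {f : ℝ → ℝ} {f' a : ℝ} (hf : HasDerivAt f f' a)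
    (h : ∀ᶠ s in 𝓝[>] a, f a ≤ f s) : 0 ≤ f' := by
  refine ge_of_tendsto ((hasDerivWithinAt_iff_tendsto_slope' self_notMem_Ioi).1
    (hf.hasDerivWithinAt (s := Ioi a))) ?_
  filter_upwards [h, self_mem_nhdsWithin] with s hs hsa
  rw [slope_def_field]
  exact div_nonneg (sub_nonneg.2 hs) (sub_nonneg.2 (le_of_lt hsa))

theorem exists_kuramotoField_eq_zero (hN : 1 ≤ N) {γ : ℝ} (hγ : 0 < γ) {ω : Fin N → ℝ}
    (hω : ω ∈ meanZero N) (hspread : spread ω < γ) :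
    ∃ θ : Fin N → ℝ, kuramotoField γ ω θ = 0 ∧ ∀ i j, θ i - θ j < Real.pi / 2 := by
  obtain ⟨θ, hθ, hmin⟩ := exists_isMinOn_quarterArc hN (γ := γ) hω
  have hlt : ∀ i j, θ i - θ j < Real.pi / 2 := by
    intro i k
    refine lt_of_le_of_ne (hθ i k) fun hik => ?_
    have hne : i ≠ k := by
      rintro rfl
      linarith [Real.pi_pos]
    -- Moving the extremes `i` and `k` towards each other stays in the arc, so minimality makes this
    -- derivative nonnegative; it equals the field difference shown negative below.
    have hd := hasDerivAt_kuramotoEnergy_line γ ω θ (Pi.single k 1 - Pi.single i 1)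
    have hnonneg := hd.nonneg_of_eventually_ge_right (by
      filter_upwards [Ioo_mem_nhdsGT (show (0 : ℝ) < Real.pi / 2 by positivity)] with s hs
      have hmem : (fun p => θ p + s * (Pi.single k 1 - Pi.single i 1 : Fin N → ℝ) p) ∈
          quarterArc N := by
        have hbd : ∀ p, θ k ≤ θ p + s * (Pi.single k 1 - Pi.single i 1 : Fin N → ℝ) p ∧
            θ p + s * (Pi.single k 1 - Pi.single i 1 : Fin N → ℝ) p ≤ θ i := by
          intro p
          by_cases hpi : p = i
          · subst hpi
            simp [hne]
            constructor <;> linarith [hs.1, hs.2]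
          · by_cases hpk : p = k
            · subst hpk
              simp [hpi]
              constructor <;> linarith [hs.1, hs.2]
            · simp [hpi, hpk]
              constructor <;> linarith [hθ p k, hθ i p]
        intro p q
        linarith [(hbd p).2, (hbd q).1]
      simpa using hmin hmem)
    have hneg := kuramotoField_sub_neg_of_extremal hγ hspread hθ hik
    simp [sub_mul, Finset.sum_sub_distrib, Pi.single_apply] at hnonneg
    linarith
  refine ⟨θ, funext fun i => ?_, hlt⟩
  have hd := hasDerivAt_kuramotoEnergy_line γ ω θ (Pi.single i 1)
  have hloc : IsLocalMin
      (fun s : ℝ => kuramotoEnergy γ ω (fun p => θ p + s * (Pi.single i 1 : Fin N → ℝ) p)) 0 := by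
    have hev : ∀ᶠ s : ℝ in 𝓝 0, ∀ p q, (θ p + s * (Pi.single i 1 : Fin N → ℝ) p) -
        (θ q + s * (Pi.single i 1 : Fin N → ℝ) q) < Real.pi / 2 := by
      refine eventually_all.2 fun p => eventually_all.2 fun q => ?_
      refine (Continuous.tendsto (by fun_prop) (0 : ℝ)).eventually_lt_const ?_
      simpa using hlt p q
    filter_upwards [hev] with s hs
    simpa using hmin (show (fun p => θ p + s * (Pi.single i 1 : Fin N → ℝ) p) ∈ quarterArc N
      from fun p q => (hs p q).le)
  have h0 := hloc.hasDerivAt_eq_zero hd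
  simpa [Pi.single_apply] using h0

end Energy

/-! ### The Chopra-Spong bound -/

section ChopraSpong

variable {N : ℕ}

theorem chopraSpongFun_le (N : ℕ) (φ : ℝ) : chopraSpongFun N φ ≤ chopraSpong N :=
  (chopraSpong_isGreatest N).2 ⟨φ, rfl⟩

theorem chopraSpong_pos (hN : 1 ≤ N) : 0 < chopraSpong N := by
  rcases hN.eq_or_lt with rfl | hN
  · have h := chopraSpongFun_le 1 (-(Real.pi / 2))
    have e : (2 : ℝ) * -(Real.pi / 2) = -Real.pi := by ring
    norm_num [chopraSpongFun, e] at h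
    linarith
  · have h := chopraSpongFun_le N (Real.pi / 4)
    have e : (2 : ℝ) * (Real.pi / 4) = Real.pi / 2 := by ring
    have hN' : (2 : ℝ) ≤ N := by exact_mod_cast hN
    have hs : 0 ≤ Real.sin (Real.pi / 4) := by
      rw [Real.sin_pi_div_four]
      positivity
    rw [chopraSpongFun, e, Real.sin_pi_div_two] at h
    nlinarith [mul_nonneg (sub_nonneg.2 hN') hs]

theorem chopraSpong_le_natCast (hN : 2 ≤ N) : chopraSpong N ≤ N := by
  have hN' : (2 : ℝ) ≤ N := by exact_mod_cast hN
  refine ciSup_le fun φ => ?_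
  rw [chopraSpongFun]
  nlinarith [Real.sin_le_one φ, Real.sin_le_one (2 * φ),
    mul_nonneg (sub_nonneg.2 hN') (sub_nonneg.2 (Real.sin_le_one φ))]

/-- `d / 2` modulo `π`, chosen with nonnegative sine. -/
theorem exists_half_angle (d : ℝ) :
    ∃ φ, 0 ≤ Real.sin φ ∧ Real.sin d = Real.sin (2 * φ) ∧ Real.cos d = Real.cos (2 * φ) ∧
      ∀ a b, a + b = d → ∃ u, a = φ + u ∧ Real.sin b = Real.sin (φ - u) ∧
        Real.cos b = Real.cos (φ - u) := by
  rcases le_total 0 (Real.sin (d / 2)) with h | h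
  · refine ⟨d / 2, h, by ring_nf, by ring_nf, fun a b hab => ⟨a - d / 2, by ring, ?_, ?_⟩⟩ <;>
    · congr 1
      linarith
  · have e : 2 * (d / 2 + Real.pi) = d + 2 * Real.pi := by ring
    refine ⟨d / 2 + Real.pi, ?_, ?_, ?_, fun a b hab => ⟨a - (d / 2 + Real.pi), by ring, ?_, ?_⟩⟩
    · rw [Real.sin_add_pi]
      linarith
    · rw [e, Real.sin_add_two_pi]
    · rw [e, Real.cos_add_two_pi]
    · rw [← Real.sin_add_two_pi b]
      congr 1
      linarith
    · rw [← Real.cos_add_two_pi b]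
      congr 1
      linarith

theorem sum_eq_add_add_sum_compl_pair {i k : Fin N} (hik : i ≠ k) (f : Fin N → ℝ) :
    ∑ j, f j = f i + f k + ∑ j ∈ ({i, k} : Finset (Fin N))ᶜ, f j := by
  rw [← Finset.sum_add_sum_compl {i, k} f, Finset.sum_pair hik]

theorem card_compl_pair {i k : Fin N} (hik : i ≠ k) :
    ((({i, k} : Finset (Fin N))ᶜ.card : ℕ) : ℝ) = (N : ℝ) - 2 := by
  have h := Finset.card_add_card_compl ({i, k} : Finset (Fin N))
  rw [Finset.card_pair hik, Fintype.card_fin] at h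
  have h' : (2 : ℝ) + (({i, k} : Finset (Fin N))ᶜ.card : ℕ) = N := by exact_mod_cast h
  linarith

/-- For each pair of oscillators the sines of the phase differences obey the Chopra-Spong bound;
when it is attained, the other oscillators sit symmetrically between the two. -/
theorem sum_sin_add_sin_le (θ : Fin N → ℝ) {i k : Fin N} (hik : i ≠ k) :
    ∑ j, (Real.sin (θ i - θ j) + Real.sin (θ j - θ k)) ≤ 2 * chopraSpong N ∧
    (2 * chopraSpong N ≤ ∑ j, (Real.sin (θ i - θ j) + Real.sin (θ j - θ k)) →
      ∃ φ, chopraSpongFun N φ = chopraSpong N ∧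
        Real.sin (θ i - θ k) = Real.sin (2 * φ) ∧ Real.cos (θ i - θ k) = Real.cos (2 * φ) ∧
        ∀ j, j ≠ i → j ≠ k →
          Real.sin (θ i - θ j) = Real.sin φ ∧ Real.cos (θ i - θ j) = Real.cos φ ∧
          Real.sin (θ j - θ k) = Real.sin φ ∧ Real.cos (θ j - θ k) = Real.cos φ) := by
  have hNpos : 1 ≤ N := i.pos
  obtain ⟨φ, hφ, hsin, hcos, hsplit⟩ := exists_half_angle (θ i - θ k)
  have hτ := chopraSpongFun_le N φ
  have hsum : ∑ j, (Real.sin (θ i - θ j) + Real.sin (θ j - θ k)) = 2 * Real.sin (2 * φ) +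
      ∑ j ∈ ({i, k} : Finset (Fin N))ᶜ, (Real.sin (θ i - θ j) + Real.sin (θ j - θ k)) := by
    rw [sum_eq_add_add_sum_compl_pair hik]
    simp only [sub_self, Real.sin_zero, hsin]
    ring
  have hconst : ∑ _j ∈ ({i, k} : Finset (Fin N))ᶜ, 2 * Real.sin φ =
      2 * (((N : ℝ) - 2) * Real.sin φ) := by
    rw [Finset.sum_const, nsmul_eq_mul, card_compl_pair hik]
    ring
  choose u hu1 hu2 hu3 using fun j => hsplit (θ i - θ j) (θ j - θ k) (by ring)
  have hterm : ∀ j, Real.sin (θ i - θ j) + Real.sin (θ j - θ k) =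
      2 * Real.sin φ * Real.cos (u j) := by
    intro j
    rw [hu1 j, hu2 j, Real.sin_add, Real.sin_sub]
    ring
  have hle : ∀ j ∈ ({i, k} : Finset (Fin N))ᶜ,
      Real.sin (θ i - θ j) + Real.sin (θ j - θ k) ≤ 2 * Real.sin φ := by
    intro j _
    rw [hterm]
    exact mul_le_of_le_one_right (by linarith) (Real.cos_le_one _)
  have hsle := Finset.sum_le_sum hle
  rw [chopraSpongFun] at hτ
  refine ⟨by rw [hsum]; linarith, fun heq => ?_⟩
  have hfun : chopraSpongFun N φ = chopraSpong N := by
    rw [chopraSpongFun]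
    linarith
  -- Needed to cancel `sin φ` in the termwise equality and conclude `cos (u j) = 1`.
  have hφpos : 0 < Real.sin φ := by
    refine lt_of_le_of_ne hφ fun h0 => ?_
    have := chopraSpong_pos hNpos
    rw [← hfun, chopraSpongFun, Real.sin_two_mul, ← h0] at this
    simp at this
  have hall := (Finset.sum_eq_sum_iff_of_le hle).1 (by linarith)
  refine ⟨φ, hfun, hsin, hcos, fun j hji hjk => ?_⟩
  have hj := hall j (by simp [hji, hjk])
  rw [hterm] at hj
  have hc : Real.cos (u j) = 1 := by
    have : 2 * Real.sin φ * (Real.cos (u j) - 1) = 0 := by linarith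
    rcases mul_eq_zero.1 this with h | h <;> linarith
  have hs : Real.sin (u j) = 0 := by
    have := Real.sin_sq_add_cos_sq (u j)
    rw [hc] at this
    exact pow_eq_zero_iff two_ne_zero |>.1 (by linarith)
  rw [hu2 j, hu3 j, hu1 j, Real.sin_add, Real.cos_add, Real.sin_sub, Real.cos_sub, hc, hs]
  simp

/-- With `c = γ / N` this is the Kuramoto flow restricted to the invariant line of the equality
case. -/
theorem exists_chopraSpong_drift_solution (N : ℕ) (c φ s₀ : ℝ) :
    ∃ u : ℝ → ℝ, u 0 = s₀ ∧
      ∀ t, HasDerivAt u (c * (chopraSpongFun N φ - chopraSpongFun N (φ + u t))) t := by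
  let C : NNReal := ⟨|c| * (|(N : ℝ) - 2| + 2), by positivity⟩
  let L : NNReal := ⟨|c| * (2 * (|(N : ℝ) - 2| + 1)), by positivity⟩
  have hderiv : ∀ s, HasDerivAt (fun s => c * (chopraSpongFun N φ - chopraSpongFun N (φ + s)))
      (c * -(((N : ℝ) - 2) * Real.cos (φ + s) + Real.cos (2 * (φ + s)) * 2)) s := by
    intro s
    have h1 : HasDerivAt (fun s => φ + s) 1 s := (hasDerivAt_id s).const_add φ
    have h2 : HasDerivAt (fun s => 2 * (φ + s)) 2 s := by simpa using h1.const_mul 2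
    have h3 := (((h1.sin.const_mul ((N : ℝ) - 2)).add h2.sin).const_sub
      (chopraSpongFun N φ)).const_mul c
    exact h3.congr_deriv (by ring)
  have hlip : LipschitzWith C
      (fun s => c * (chopraSpongFun N φ - chopraSpongFun N (φ + s))) := by
    refine lipschitzWith_of_nnnorm_deriv_le (fun s => (hderiv s).differentiableAt) fun s => ?_
    rw [(hderiv s).deriv, ← NNReal.coe_le_coe, coe_nnnorm, Real.norm_eq_abs, abs_mul, abs_neg]
    refine mul_le_mul_of_nonneg_left ((abs_add_le _ _).trans (add_le_add ?_ ?_)) (abs_nonneg c)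
    · rw [abs_mul]
      exact mul_le_of_le_one_right (abs_nonneg _) (Real.abs_cos_le_one _)
    · rw [abs_mul, abs_two]
      linarith [Real.abs_cos_le_one (2 * (φ + s))]
  have hbd : ∀ ψ, |chopraSpongFun N ψ| ≤ |(N : ℝ) - 2| + 1 := by
    intro ψ
    refine (abs_add_le _ _).trans (add_le_add ?_ (Real.abs_sin_le_one _))
    rw [abs_mul]
    exact mul_le_of_le_one_right (abs_nonneg _) (Real.abs_sin_le_one _)
  refine exists_global_solution_of_lipschitzWith (L := L) hlip (fun s => ?_) s₀
  rw [Real.norm_eq_abs, abs_mul]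
  refine mul_le_mul_of_nonneg_left ((abs_sub _ _).trans ?_) (abs_nonneg c)
  linarith [hbd φ, hbd (φ + s)]

theorem spread_lt_of_isStableFixedPoint {γ : ℝ} (hN : 1 ≤ N) (hγ : 0 < γ) {ω θ : Fin N → ℝ}
    (h : IsStableFixedPoint γ ω θ) : spread ω < 2 * chopraSpong N * γ / N := by
  have hN' : (0 : ℝ) < N := by exact_mod_cast hN
  have hτ := chopraSpong_pos hN
  obtain ⟨i, k, hspread⟩ := exists_spread_eq hN ω
  rw [hspread]
  by_cases hik : i = k
  · rw [hik, sub_self]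
    positivity
  obtain ⟨hle, hattain⟩ := sum_sin_add_sin_le θ hik
  have hω : ω i - ω k = γ / N * ∑ j, (Real.sin (θ i - θ j) + Real.sin (θ j - θ k)) := by
    have h1 := kuramotoField_sub γ ω θ i k
    rw [h.fixed] at h1
    simp only [Pi.zero_apply, sub_self] at h1
    linarith
  have hbound : 2 * chopraSpong N * γ / N = γ / N * (2 * chopraSpong N) := by ring
  rw [hω, hbound]
  refine mul_lt_mul_of_pos_left (lt_of_not_ge fun hge => ?_) (by positivity)
  obtain ⟨φ, hφ, hsin, hcos, hmid⟩ := hattain hge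
  obtain ⟨δ, hδ, hattr⟩ := h.attracting
  obtain ⟨u, hu0, hu⟩ := exists_chopraSpong_drift_solution N (γ / N) φ (δ / 2)
  -- The velocity is nonnegative since `φ` is a maximizer, so `u` never falls below `δ / 2`.
  have hmono : Monotone u := by
    refine monotone_of_deriv_nonneg (fun t => (hu t).differentiableAt) fun t => ?_
    rw [(hu t).deriv, hφ]
    exact mul_nonneg (by positivity) (sub_nonneg.2 (chopraSpongFun_le N _))
  let e : Fin N → ℝ := Pi.single i 1 - Pi.single k 1
  have hei : e i = 1 := by simp [e, hik]
  have hek : e k = -1 := by simp [e, Ne.symm hik]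
  have hej : ∀ j, j ≠ i → j ≠ k → e j = 0 := fun j hi hk => by simp [e, hi, hk]
  have hfield : ∀ s, kuramotoField γ ω (fun p => θ p + s * e p) =
      fun p => γ / N * (chopraSpongFun N φ - chopraSpongFun N (φ + s)) * e p := by
    have hpair : ∀ s, Real.sin (θ i + s * e i - (θ k + s * e k)) = Real.sin (2 * (φ + s)) := by
      intro s
      have h1 : θ i + s * e i - (θ k + s * e k) = (θ i - θ k) + 2 * s := by
        rw [hei, hek]
        ring
      rw [h1, mul_add, Real.sin_add, Real.sin_add, hsin, hcos]
    have hmid_left : ∀ s j, j ≠ i → j ≠ k →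
        Real.sin (θ i + s * e i - (θ j + s * e j)) = Real.sin (φ + s) := by
      intro s j hji hjk
      have h1 : θ i + s * e i - (θ j + s * e j) = (θ i - θ j) + s := by
        rw [hei, hej j hji hjk]
        ring
      rw [h1, Real.sin_add, Real.sin_add, (hmid j hji hjk).1, (hmid j hji hjk).2.1]
    have hmid_right : ∀ s j, j ≠ i → j ≠ k →
        Real.sin (θ j + s * e j - (θ k + s * e k)) = Real.sin (φ + s) := by
      intro s j hji hjk
      have h1 : θ j + s * e j - (θ k + s * e k) = (θ j - θ k) + s := by
        rw [hek, hej j hji hjk]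
        ring
      rw [h1, Real.sin_add, Real.sin_add, (hmid j hji hjk).2.2.1, (hmid j hji hjk).2.2.2]
    have hsum : ∀ s p, ∑ j, Real.sin (θ j + s * e j - (θ p + s * e p)) =
        ∑ j, Real.sin (θ j - θ p) + (chopraSpongFun N φ - chopraSpongFun N (φ + s)) * e p := by
      have hval_left : ∀ s, ∑ j, Real.sin (θ j + s * e j - (θ i + s * e i)) =
          -chopraSpongFun N (φ + s) := by
        intro s
        have hc : ∀ j ∈ ({i, k} : Finset (Fin N))ᶜ,
            Real.sin (θ j + s * e j - (θ i + s * e i)) = -Real.sin (φ + s) := by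
          intro j hj
          simp only [Finset.mem_compl, Finset.mem_insert, Finset.mem_singleton, not_or] at hj
          rw [← hmid_left s j hj.1 hj.2, ← Real.sin_neg, neg_sub]
        rw [sum_eq_add_add_sum_compl_pair hik, Finset.sum_congr rfl hc, Finset.sum_const,
          nsmul_eq_mul, card_compl_pair hik, sub_self, Real.sin_zero,
          ← neg_sub (θ i + s * e i), Real.sin_neg, hpair, chopraSpongFun]
        ring
      have hval_right : ∀ s, ∑ j, Real.sin (θ j + s * e j - (θ k + s * e k)) =
          chopraSpongFun N (φ + s) := by
        intro s
        have hc : ∀ j ∈ ({i, k} : Finset (Fin N))ᶜ,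
            Real.sin (θ j + s * e j - (θ k + s * e k)) = Real.sin (φ + s) := by
          intro j hj
          simp only [Finset.mem_compl, Finset.mem_insert, Finset.mem_singleton, not_or] at hj
          exact hmid_right s j hj.1 hj.2
        rw [sum_eq_add_add_sum_compl_pair hik, Finset.sum_congr rfl hc, Finset.sum_const,
          nsmul_eq_mul, card_compl_pair hik, sub_self, Real.sin_zero, hpair, chopraSpongFun]
        ring
      intro s p
      by_cases hpi : p = i
      · have h0 := hval_left 0
        simp only [zero_mul, add_zero] at h0
        rw [hpi, hval_left, h0, hei]
        ring
      by_cases hpk : p = k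
      · have h0 := hval_right 0
        simp only [zero_mul, add_zero] at h0
        rw [hpk, hval_right, h0, hek]
        ring
      -- A middle oscillator feels opposite pulls from `i` and `k`, so it stays at rest.
      have hbalance : ∀ s, Real.sin (θ i + s * e i - (θ p + s * e p)) +
          Real.sin (θ k + s * e k - (θ p + s * e p)) = 0 := by
        intro s
        rw [← neg_sub (θ p + s * e p) (θ k + s * e k), Real.sin_neg, hmid_left s p hpi hpk,
          hmid_right s p hpi hpk, add_neg_cancel]
      have hbalance_zero := hbalance 0
      simp only [zero_mul, add_zero] at hbalance_zero
      rw [sum_eq_add_add_sum_compl_pair hik, hbalance,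
        sum_eq_add_add_sum_compl_pair hik (fun j => Real.sin (θ j - θ p)), hbalance_zero,
        hej p hpi hpk]
      simp only [mul_zero, add_zero, zero_add]
      refine Finset.sum_congr rfl fun j hj => ?_
      simp only [Finset.mem_compl, Finset.mem_insert, Finset.mem_singleton, not_or] at hj
      rw [hej j hj.1 hj.2, mul_zero, add_zero]
    intro s
    funext p
    have h0 : ω p + γ / N * ∑ j, Real.sin (θ j - θ p) = 0 := congrFun h.fixed p
    rw [kuramotoField, hsum]
    linear_combination h0
  let x : ℝ → Fin N → ℝ := fun t p => θ p + u t * e p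
  have hx : IsKuramotoSolution γ ω x := by
    intro t _
    rw [hfield, hasDerivWithinAt_pi]
    exact fun p => (((hu t).mul_const (e p)).const_add (θ p)).hasDerivWithinAt
  have hx0 : Metric.infDist (x 0) (rotationOrbit θ) < δ := by
    refine lt_of_le_of_lt (infDist_rotationOrbit_le (c := 0) (δ := δ / 2) (by positivity)
      fun p => ?_) (half_lt_self hδ)
    have hp : |e p| ≤ 1 := by
      by_cases hpi : p = i
      · rw [hpi, hei, abs_one]
      by_cases hpk : p = k
      · rw [hpk, hek, abs_neg, abs_one]
      rw [hej p hpi hpk, abs_zero]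
      exact zero_le_one
    have he : x 0 p - θ p - 0 = δ / 2 * e p := by
      simp only [x, hu0]
      ring
    rw [he, abs_mul, abs_of_pos (half_pos hδ)]
    exact mul_le_of_le_one_right (half_pos hδ).le hp
  -- Orbit distance below `δ / 2` forces `|2 * u t| < δ`, against `u t ≥ δ / 2`.
  obtain ⟨t, ht0, ht⟩ := ((eventually_ge_atTop (0 : ℝ)).and
    ((hattr x hx hx0).eventually_lt_const (half_pos hδ))).exists
  have hlt := abs_sub_sub_lt_of_infDist_rotationOrbit_lt ht i k
  have hdiff : (x t i - θ i) - (x t k - θ k) = 2 * u t := by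
    simp only [x, hei, hek]
    ring
  rw [hdiff] at hlt
  have := hmono ht0
  rw [hu0] at this
  linarith [le_abs_self (2 * u t)]

end ChopraSpong

theorem mainTheorem3 (N : ℕ) (hN : 1 ≤ N) (γ : ℝ) (hγ : 0 < γ) :
    {ω | ω ∈ meanZero N ∧ spread ω < γ} ⊆ phaseLockedRegion N γ ∧
    phaseLockedRegion N γ ⊆
      {ω | ω ∈ meanZero N ∧ spread ω < 2 * chopraSpong N * γ / (N : ℝ)} ∧
    {ω | ω ∈ meanZero N ∧ spread ω < 2 * chopraSpong N * γ / (N : ℝ)} ⊆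
      {ω | ω ∈ meanZero N ∧ spread ω < 2 * γ} := by
  refine ⟨?_, ?_, ?_⟩
  · rintro ω ⟨hω, hspread⟩
    obtain ⟨θ, hfix, hθ⟩ := exists_kuramotoField_eq_zero hN hγ hω hspread
    exact ⟨hω, θ, isStableFixedPoint_of_abs_sub_lt hγ hN hω hfix hθ⟩
  · rintro ω ⟨hω, θ, hθ⟩
    exact ⟨hω, spread_lt_of_isStableFixedPoint hN hγ hθ⟩
  · rintro ω ⟨hω, hspread⟩
    refine ⟨hω, ?_⟩
    -- For `N = 1` the constant exceeds `N`, but a single frequency has zero spread.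
    rcases hN.eq_or_lt with rfl | hN2
    · have : spread ω = 0 := by simp [spread]
      rw [this]
      positivity
    · have hN' : (0 : ℝ) < N := by exact_mod_cast hN
      refine hspread.trans_le ?_
      rw [div_le_iff₀ hN']
      nlinarith [chopraSpong_le_natCast hN2]
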